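/- Let $G < \mathrm{GL}_2(\mathbb{C})$ be a finite subgroup that is small, i.e. contains no pseudo-reflection (no element $g$ of finite order with $\operatorname{rank}(g-1)=1$), and suppose that $G \not\subseteq \mathrm{SL}_2(\mathbb{C})$. Let $W=\mathbb{C}^2$ be the natural representation of $G$ and let $\det W$ be its determinant, a one-dimensional representation. The McKay quiver of $(G,W)$ is the quiver with one vertex for each isomorphism class of (finite-dimensional) complex irreducible representations $W_i$ of $G$ and with $\dim_{\mathbb{C}} \operatorname{Hom}_G(W_i\otimes W, W_j)$ arrows from $W_i$ to $W_j$. Then for every irreducible representation $W_i$ of $G$ there is a path in the McKay quiver from $W_i$ to the irreducible representation $\det W\otimes W_i$, and a shortest such path has length at least $2$ (the trivial path at a vertex has length $0$). -/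

import Mathlib

open scoped TensorProduct

noncomputable section

namespace McKay

/-- The natural representation `W = ℂⁿ` of a subgroup `G` of `GL_n(ℂ)`. -/
def naturalRep {n : ℕ} (G : Subgroup (GL (Fin n) ℂ)) : Representation ℂ G (Fin n → ℂ) :=
  ((Matrix.toLinAlgEquiv' : Matrix (Fin n) (Fin n) ℂ ≃ₐ[ℂ] _) : _ →* _).comp
    ((Units.coeHom (Matrix (Fin n) (Fin n) ℂ)).comp G.subtype)

/-- The determinant `det W` of a representation `W`, a representation on the line `ℂ`. -/
def detRep {G W : Type*} [Group G] [AddCommGroup W] [Module ℂ W] (ω : Representation ℂ G W) :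
    Representation ℂ G ℂ where
  toFun g := LinearMap.det (ω g) • LinearMap.id
  map_one' := by ext; simp
  map_mul' g h := by ext; simp [mul_comm]

/-- A pseudo-reflection in `GL_n(ℂ)`: an element of finite order whose fixed space is a hyperplane,
i.e. such that `g - 1` has rank one. -/
def IsPseudoReflection {n : ℕ} (g : GL (Fin n) ℂ) : Prop :=
  IsOfFinOrder g ∧ ((g : Matrix (Fin n) (Fin n) ℂ) - 1).rank = 1

/-- A subgroup of `GL_n(ℂ)` is small if it contains no pseudo-reflection. -/
def IsSmall {n : ℕ} (G : Subgroup (GL (Fin n) ℂ)) : Prop :=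
  ∀ g ∈ G, ¬ IsPseudoReflection g

/-- A finite-dimensional irreducible complex representation of `G`. -/
structure Irrep (G : Type*) [Group G] where
  /-- the underlying space -/
  V : Type
  [addCommGroup : AddCommGroup V]
  [module : Module ℂ V]
  [finiteDimensional : FiniteDimensional ℂ V]
  /-- the action -/
  ρ : Representation ℂ G V
  irreducible : ρ.IsIrreducible

attribute [instance] Irrep.addCommGroup Irrep.module Irrep.finiteDimensional

/-- Isomorphism of irreducible representations. -/
instance Irrep.setoid (G : Type*) [Group G] : Setoid (Irrep G) where
  r A B := Nonempty (A.ρ.Equiv B.ρ)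
  iseqv := ⟨fun A => ⟨.refl A.ρ⟩, fun ⟨e⟩ => ⟨e.symm⟩, fun ⟨e⟩ ⟨f⟩ => ⟨e.trans f⟩⟩

/-- `dim Hom_G(A ⊗ W, B)`. -/
def Irrep.mult {G W : Type*} [Group G] [AddCommGroup W] [Module ℂ W] (ω : Representation ℂ G W)
    (A B : Irrep G) : ℕ :=
  Module.finrank ℂ ((A.ρ.tprod ω).IntertwiningMap B.ρ)

theorem Irrep.mult_congr {G W : Type*} [Group G] [AddCommGroup W] [Module ℂ W]
    (ω : Representation ℂ G W) (A B A' B' : Irrep G) (hA : A ≈ A') (hB : B ≈ B') :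
    A.mult ω B = A'.mult ω B' := by
  obtain ⟨e⟩ := hA
  obtain ⟨f⟩ := hB
  refine LinearEquiv.finrank_eq
    { toFun := fun φ => (f.toIntertwiningMap.comp φ).comp (e.symm.toIntertwiningMap.rTensor ω)
      invFun := fun φ => (f.symm.toIntertwiningMap.comp φ).comp (e.toIntertwiningMap.rTensor ω)
      map_add' := fun φ ψ => ?_
      map_smul' := fun c φ => ?_
      left_inv := fun φ => ?_
      right_inv := fun φ => ?_ }
  all_goals
    apply Representation.IntertwiningMap.toLinearMap_injective
    apply TensorProduct.ext'
    intro a w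
    simp [Representation.IntertwiningMap.toLinearMap_apply]

/-- The vertices of the McKay quiver of `(G, W)`: isomorphism classes of irreducible
representations of `G`. -/
def Quiv {G W : Type*} [Group G] [AddCommGroup W] [Module ℂ W] (_ω : Representation ℂ G W) :=
  Quotient (Irrep.setoid G)

/-- The McKay quiver of `(G, W)` has `dim Hom_G(V_i ⊗ W, V_j)` arrows from `V_i` to `V_j`. -/
instance {G W : Type*} [Group G] [AddCommGroup W] [Module ℂ W] (ω : Representation ℂ G W) :
    Quiver (Quiv ω) where
  Hom i j := Fin (Quotient.lift₂ (Irrep.mult ω) (Irrep.mult_congr ω) i j)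

/-- The vertex of the McKay quiver given by an irreducible representation. -/
def vertex {G W : Type*} [Group G] [AddCommGroup W] [Module ℂ W] (ω : Representation ℂ G W)
    (A : Irrep G) : Quiv ω :=
  Quotient.mk (Irrep.setoid G) A

theorem tprod_isIrreducible {G V : Type*} [Group G] [AddCommGroup V] [Module ℂ V]
    (χ : Representation ℂ G ℂ) (ρ : Representation ℂ G V) (hρ : ρ.IsIrreducible) :
    (χ.tprod ρ).IsIrreducible := by
  have hχ : ∀ g c, χ g c = c * χ g 1 := fun g c => by
    rw [← smul_eq_mul, ← map_smul, smul_eq_mul, mul_one]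
  have hne : ∀ g, χ g 1 ≠ 0 := fun g h => by
    have h1 : χ (g⁻¹ * g) 1 = 0 := by rw [map_mul, Module.End.mul_apply, h, map_zero]
    simp at h1
  have key : ∀ (g : G) (x : ℂ ⊗[ℂ] V), TensorProduct.lid ℂ V (χ.tprod ρ g x) =
      χ g 1 • ρ g (TensorProduct.lid ℂ V x) := fun g x => by
    induction x using TensorProduct.induction_on with
    | zero => simp
    | tmul c v => simp [hχ g c, mul_smul, smul_comm c]
    | add x y hx hy => simp only [map_add, hx, hy, smul_add]
  have key' : ∀ (g : G) (v : V), χ.tprod ρ g ((TensorProduct.lid ℂ V).symm v) =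
      χ g 1 • (TensorProduct.lid ℂ V).symm (ρ g v) := fun g v => by
    apply (TensorProduct.lid ℂ V).injective
    rw [key]; simp
  let E : Subrepresentation ρ ≃o Subrepresentation (χ.tprod ρ) :=
    { toFun := fun S => ⟨S.toSubmodule.comap (TensorProduct.lid ℂ V).toLinearMap,
        fun g x hx => by
          rw [Submodule.mem_comap] at hx ⊢
          change TensorProduct.lid ℂ V _ ∈ _
          rw [key]
          exact S.toSubmodule.smul_mem _ (S.apply_mem_toSubmodule g hx)⟩
      invFun := fun T => ⟨T.toSubmodule.comap (TensorProduct.lid ℂ V).symm.toLinearMap,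
        fun g v hv => by
          rw [Submodule.mem_comap] at hv ⊢
          have h := T.apply_mem_toSubmodule g hv
          change χ.tprod ρ g ((TensorProduct.lid ℂ V).symm v) ∈ _ at h
          rw [key'] at h
          exact (T.toSubmodule.smul_mem_iff (hne g)).1 h⟩
      left_inv := fun S => by
        ext v
        simp
      right_inv := fun T => by
        ext v
        simp
      map_rel_iff' := fun {S T} => by
        constructor
        · intro h v hv
          have := @h ((TensorProduct.lid ℂ V).symm v) (by
            change TensorProduct.lid ℂ V _ ∈ S.toSubmodule
            rw [LinearEquiv.apply_symm_apply]
            exact hv)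
          change TensorProduct.lid ℂ V _ ∈ T.toSubmodule at this
          rw [LinearEquiv.apply_symm_apply] at this
          exact this
        · intro h x hx
          exact h hx }
  exact (OrderIso.isSimpleOrder_iff E).1 hρ

/-- The irreducible representation `χ ⊗ A`, for `χ` a representation on the line `ℂ`. -/
def Irrep.twist {G : Type*} [Group G] (χ : Representation ℂ G ℂ) (A : Irrep G) : Irrep G where
  V := ℂ ⊗[ℂ] A.V
  ρ := χ.tprod A.ρ
  irreducible := tprod_isIrreducible χ A.ρ A.irreducible

end McKay

end

open scoped TensorProduct

namespace McKay

/-! Write `χ` for the character of `W`, and call an action free when no element other than 1 fixes a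
nonzero vector; a finite small group acts freely on the plane. The projection of `W ⊗ W` onto its
exterior square gives a nonzero map `A ⊗ W ⊗ W → det W ⊗ A`. It factors nontrivially through an
irreducible constituent of `A ⊗ W`, so there is a path of length 2. It remains to exclude lengths 0
and 1.

Length 0 (`not_nonempty_equiv_twist`): if `A ≅ det W ⊗ A`, Schur's lemma forces determinant 1 on
central elements, so the only possible scalars in `G` are `±1`. Then `commute_or_det_eq_one` shows
that `G` is abelian, hence central in itself, or of determinant 1; both give `G ⊆ SL₂`.

Length 1 (`intertwiningMap_twist_eq_zero`): if `-1 ∈ G`, it acts on `A ⊗ W` and on `det W ⊗ A` by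
opposite scalars. Otherwise `G` is abelian by `commute_of_map_ne_neg_one`, and an arrow would make
`det g` an eigenvalue of every `g`; the other eigenvalue is then 1, so freeness gives `g = 1`.

Both structure results avoid the classification of finite groups. On a set stable under powers prime
to the group order, the product of the values of `χ` is a rational integer. If these values are
nonzero and have mean square 1, the equality case of the arithmetic-geometric inequality gives `|χ|
= 1` there. -/

/-! ### Galois-invariant integers and the arithmetic-geometric inequality -/

open Polynomial in
/-- A nonzero complex number which is the common value of an integral polynomial at all primitive
`N`-th roots of unity has absolute value at least one. -/
theorem one_le_norm_of_eval_primitiveRoots {N : ℕ} [NeZero N] {ζ : ℂ} (hζ : IsPrimitiveRoot ζ N)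
    (f : ℤ[X]) (P : ℂ) (hP : P ≠ 0) (h : ∀ j : ℕ, j.Coprime N → aeval (ζ ^ j) f = P) :
    1 ≤ ‖P‖ := by
  let _ : Algebra ℚ (CyclotomicField N ℚ) := CyclotomicField.algebra N ℚ
  have hz : IsPrimitiveRoot (IsCyclotomicExtension.zeta N ℚ (CyclotomicField N ℚ)) N :=
    IsCyclotomicExtension.zeta_spec N ℚ (CyclotomicField N ℚ)
  set z := IsCyclotomicExtension.zeta N ℚ (CyclotomicField N ℚ)
  have hσ : ∀ σ : CyclotomicField N ℚ →ₐ[ℚ] ℂ, σ (aeval z f) = P := fun σ => by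
    have h1 : IsPrimitiveRoot (σ z) N := hz.map_of_injective σ.injective
    obtain ⟨j, -, hj, hj'⟩ := hζ.isPrimitiveRoot_iff.1 h1
    rw [← h j hj, hj']
    exact (Polynomial.aeval_algHom_apply (σ.restrictScalars ℤ) z f).symm
  have hint : IsIntegral ℤ (aeval z f) :=
    adjoin_le_integralClosure (hz.isIntegral (NeZero.pos N)) (aeval_mem_adjoin_singleton ℤ z)
  obtain ⟨n, hn⟩ := IsIntegrallyClosed.isIntegral_iff.1 (Algebra.isIntegral_norm ℚ hint)
  -- Every embedding sends `aeval z f` to `P`, so its norm, a nonzero integer, is a power of `P`.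
  have hprod := Algebra.norm_eq_prod_embeddings ℚ ℂ (aeval z f)
  rw [Finset.prod_congr rfl fun σ _ => hσ σ, Finset.prod_const, ← hn] at hprod
  have hn0 : n ≠ 0 := by
    rintro rfl
    simp only [map_zero] at hprod
    exact pow_ne_zero _ hP hprod.symm
  have hnorm : (1 : ℝ) ≤ ‖P‖ ^ (Finset.univ : Finset (CyclotomicField N ℚ →ₐ[ℚ] ℂ)).card := by
    rw [← norm_pow, ← hprod]
    simp only [eq_intCast, map_intCast, Complex.norm_intCast]
    exact_mod_cast Int.one_le_abs hn0
  by_contra! hlt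
  have hcard : (Finset.univ : Finset (CyclotomicField N ℚ →ₐ[ℚ] ℂ)).card ≠ 0 := by
    rw [Finset.card_univ, AlgHom.card]
    exact Module.finrank_pos.ne'
  exact absurd hnorm (not_le.2 (pow_lt_one₀ (norm_nonneg _) hlt hcard))

/-- Equality case of the inequality between arithmetic and geometric means, for positive reals of
product at least one and of mean one. -/
theorem eq_one_of_sum_eq_card {ι : Type*} (S : Finset ι) (y : ι → ℝ) (hy : ∀ i ∈ S, 0 < y i)
    (hprod : 1 ≤ ∏ i ∈ S, y i) (hsum : ∑ i ∈ S, y i = S.card) : ∀ i ∈ S, y i = 1 := by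
  have hlog : 0 ≤ ∑ i ∈ S, Real.log (y i) := by
    rw [← Real.log_prod fun i hi => (hy i hi).ne']
    exact Real.log_nonneg hprod
  have hnn : ∀ i ∈ S, 0 ≤ y i - 1 - Real.log (y i) := fun i hi =>
    sub_nonneg.2 (Real.log_le_sub_one_of_pos (hy i hi))
  have h0 : ∑ i ∈ S, (y i - 1 - Real.log (y i)) = 0 := by
    refine le_antisymm ?_ (Finset.sum_nonneg hnn)
    simp only [Finset.sum_sub_distrib, hsum, Finset.sum_const, nsmul_eq_mul, mul_one]
    linarith
  intro i hi
  have := (Finset.sum_eq_zero_iff_of_nonneg hnn).1 h0 i hi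
  by_contra hne
  linarith [Real.log_lt_sub_one_of_pos (hy i hi) hne]

/-! ### Identities for 2 × 2 matrices -/

theorem sq_eq_trace_smul_sub_det (M : Matrix (Fin 2) (Fin 2) ℂ) :
    M ^ 2 = M.trace • M - M.det • 1 := by
  ext i j
  fin_cases i <;> fin_cases j <;>
    simp [pow_two, Matrix.mul_apply, Fin.sum_univ_two, Matrix.trace, Matrix.det_fin_two] <;> ring

theorem det_sub_one_eq (M : Matrix (Fin 2) (Fin 2) ℂ) : (M - 1).det = 1 - M.trace + M.det := by
  simp [Matrix.trace, Matrix.det_fin_two, Fin.sum_univ_two]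
  ring

/-- Two matrices commuting with a common nonscalar `2 × 2` matrix commute. -/
theorem commute_of_commute_nonscalar {X A B : Matrix (Fin 2) (Fin 2) ℂ}
    (hX : ∀ c : ℂ, X ≠ c • 1) (hA : Commute X A) (hB : Commute X B) : Commute A B := by
  -- The commutant of a nonscalar `X` is spanned by `1` and `X`; the cases are which of `X 0 1`, `X
  -- 1 0`, `X 0 0 - X 1 1` is nonzero.
  have key : ∀ C : Matrix (Fin 2) (Fin 2) ℂ, Commute X C → ∃ a b : ℂ, C = a • 1 + b • X := by
    intro C hC
    have e : ∀ i j, (X * C) i j = (C * X) i j := fun i j => by rw [hC.eq]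
    have e00 := e 0 0
    have e01 := e 0 1
    have e10 := e 1 0
    simp only [Matrix.mul_apply, Fin.sum_univ_two] at e00 e01 e10
    by_cases h1 : X 0 1 = 0
    · by_cases h2 : X 1 0 = 0
      · have h3 : X 0 0 - X 1 1 ≠ 0 := fun h => hX (X 0 0) (by
          ext i j; fin_cases i <;> fin_cases j <;> simp [h1, h2, (sub_eq_zero.1 h).symm])
        have c01 : C 0 1 = 0 := by
          apply mul_left_cancel₀ h3; rw [h1] at e01; linear_combination e01
        have c10 : C 1 0 = 0 := by
          apply mul_left_cancel₀ h3; rw [h2] at e10; linear_combination -e10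
        refine ⟨C 0 0 - (C 0 0 - C 1 1) / (X 0 0 - X 1 1) * X 0 0,
          (C 0 0 - C 1 1) / (X 0 0 - X 1 1), ?_⟩
        ext i j; fin_cases i <;> fin_cases j <;> simp [h1, h2, c01, c10]
        field_simp; ring
      · refine ⟨C 0 0 - C 1 0 / X 1 0 * X 0 0, C 1 0 / X 1 0, ?_⟩
        ext i j; fin_cases i <;> fin_cases j <;> simp [h2] <;> field_simp
        · linear_combination -e00
        · linear_combination -e10
    · refine ⟨C 0 0 - C 0 1 / X 0 1 * X 0 0, C 0 1 / X 0 1, ?_⟩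
      ext i j; fin_cases i <;> fin_cases j <;> simp [h1] <;> field_simp
      · linear_combination e00
      · linear_combination e01
  obtain ⟨a, b, rfl⟩ := key A hA
  obtain ⟨a', b', rfl⟩ := key B hB
  have h1 : ∀ (c : ℂ) (Y : Matrix (Fin 2) (Fin 2) ℂ), Commute (c • 1) Y := fun c Y =>
    (Commute.one_left Y).smul_left c
  exact (h1 _ _).add_left (((h1 _ _).symm.add_right
    (((Commute.refl X).smul_left b).smul_right b')))

/-! ### Characters of two-dimensional representations -/

section

variable {Γ : Type*} [Group Γ]

/-- The orthogonality relation for a two-dimensional representation of a finite group with trivial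
commutant. -/
theorem sum_trace_mul_trace_inv [Fintype Γ] (r : Γ →* Matrix (Fin 2) (Fin 2) ℂ)
    (hr : ∀ X, (∀ g, Commute X (r g)) → ∃ c : ℂ, X = c • 1) :
    ∑ g, (r g).trace * (r g⁻¹).trace = Fintype.card Γ := by
  have inv : ∀ g, r g⁻¹ * r g = 1 := fun g => by rw [← map_mul, inv_mul_cancel, map_one]
  -- Averaging over the group lands in the commutant, and the trace determines the scalar. Matrix
  -- units for `Y` then give the entrywise relations.
  have avg : ∀ Y : Matrix (Fin 2) (Fin 2) ℂ,
      ∑ g, r g * Y * r g⁻¹ = (Fintype.card Γ * Y.trace / 2) • 1 := fun Y => by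
    obtain ⟨c, hc⟩ := hr (∑ g, r g * Y * r g⁻¹) fun h => by
      rw [commute_iff_eq, Finset.sum_mul, Finset.mul_sum]
      refine Fintype.sum_equiv (Equiv.mulLeft h⁻¹) _ _ fun g => ?_
      simp only [Equiv.coe_mulLeft, mul_inv_rev, inv_inv, map_mul, ← mul_assoc]
      rw [← map_mul, mul_inv_cancel, map_one, one_mul]
    rw [hc]
    have ht := congrArg Matrix.trace hc
    have h1 : ∀ g, (r g * Y * r g⁻¹).trace = Y.trace := fun g => by
      rw [Matrix.trace_mul_comm, ← mul_assoc, inv, one_mul]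
    rw [Matrix.trace_sum, Finset.sum_congr rfl fun g _ => h1 g] at ht
    simp at ht
    rw [ht]
    congr 1
    ring
  have entry : ∀ i j : Fin 2, ∑ g, r g i i * r g⁻¹ j j =
      if i = j then (Fintype.card Γ / 2 : ℂ) else 0 := fun i j => by
    have h := congrFun (congrFun (avg (Matrix.single i j 1)) i) j
    rw [Matrix.sum_apply] at h
    have h2 : ∀ g, (r g * Matrix.single i j (1 : ℂ) * r g⁻¹) i j = r g i i * r g⁻¹ j j := fun g => by
      rw [Matrix.mul_apply, Finset.sum_eq_single j]
      · simp
      · intro b _ hb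
        simp [hb]
      · simp
    rw [Finset.sum_congr rfl fun g _ => h2 g] at h
    rw [h]
    by_cases hij : i = j
    · subst hij; simp
    · simp [hij]
  simp only [Matrix.trace, Fin.sum_univ_two, Matrix.diag_apply, add_mul, mul_add,
    Finset.sum_add_distrib, entry]
  simp

/-- A two-dimensional representation whose commutant contains a nonscalar matrix is commutative. -/
theorem commute_of_nonscalar_commutant (r : Γ →* Matrix (Fin 2) (Fin 2) ℂ)
    (hr : ¬ ∀ X, (∀ g, Commute X (r g)) → ∃ c : ℂ, X = c • 1) (x y : Γ) :
    Commute (r x) (r y) := by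
  push Not at hr
  obtain ⟨X, hX, hX'⟩ := hr
  exact commute_of_commute_nonscalar hX' (hX x) (hX y)

/-- The eigenvalues of a `2 × 2` matrix of finite order are roots of unity, and govern the traces of
its powers. -/
theorem exists_trace_pow_eq {N : ℕ} [NeZero N] {ζ : ℂ} (hζ : IsPrimitiveRoot ζ N)
    (M : Matrix (Fin 2) (Fin 2) ℂ) (hM : M ^ N = 1) :
    ∃ a b : ℕ, M.det = ζ ^ a * ζ ^ b ∧ ∀ j : ℕ, (M ^ j).trace = (ζ ^ j) ^ a + (ζ ^ j) ^ b := by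
  obtain ⟨s, hs⟩ := IsAlgClosed.exists_pow_nat_eq (M.trace ^ 2 - 4 * M.det) (n := 2) two_pos
  obtain ⟨α, β, hsum, hprod⟩ : ∃ α β : ℂ, α + β = M.trace ∧ α * β = M.det :=
    ⟨(M.trace + s) / 2, (M.trace - s) / 2, by ring, by linear_combination -hs / 4⟩
  have root : ∀ c : ℂ, c ^ 2 = M.trace * c - M.det → c ^ N = 1 := fun c hc => by
    have hdet : (M - c • 1).det = 0 := by
      rw [Matrix.det_fin_two] at hc ⊢
      simp [Matrix.trace, Fin.sum_univ_two] at hc ⊢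
      linear_combination hc
    obtain ⟨v, hv, hv'⟩ := Matrix.exists_mulVec_eq_zero_iff.2 hdet
    have hev : M.mulVec v = c • v := by
      rw [Matrix.sub_mulVec, sub_eq_zero] at hv'
      rw [hv', Matrix.smul_mulVec, Matrix.one_mulVec]
    have hpow : ∀ n : ℕ, (M ^ n).mulVec v = c ^ n • v := fun n => by
      induction n with
      | zero => simp
      | succ n ih => rw [pow_succ, ← Matrix.mulVec_mulVec, hev, Matrix.mulVec_smul, ih, smul_smul,
          pow_succ, mul_comm]
    have := hpow N
    rw [hM, Matrix.one_mulVec] at this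
    by_contra hne
    have h2 : (c ^ N - 1) • v = 0 := by rw [sub_smul, ← this, one_smul, sub_self]
    exact hv ((smul_eq_zero.1 h2).resolve_left (sub_ne_zero.2 hne))
  have hα : α ^ N = 1 := root α (by rw [← hsum, ← hprod]; ring)
  have hβ : β ^ N = 1 := root β (by rw [← hsum, ← hprod]; ring)
  obtain ⟨a, -, ha⟩ := hζ.eq_pow_of_pow_eq_one hα
  obtain ⟨b, -, hb⟩ := hζ.eq_pow_of_pow_eq_one hβ
  refine ⟨a, b, by rw [ha, hb, hprod], fun j => ?_⟩
  rw [← pow_mul, ← pow_mul, mul_comm j a, mul_comm j b, pow_mul, pow_mul, ha, hb]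
  -- Traces of powers and power sums of the eigenvalues satisfy the same recurrence, by
  -- Cayley–Hamilton.
  induction j using Nat.strong_induction_on with
  | _ j ih =>
    match j with
    | 0 => simp; norm_num
    | 1 => simp [hsum]
    | n + 2 =>
      rw [pow_add M, sq_eq_trace_smul_sub_det, mul_sub, mul_smul_comm, mul_smul_comm, mul_one,
        ← pow_succ, Matrix.trace_sub, Matrix.trace_smul, Matrix.trace_smul,
        ih (n + 1) (by omega), ih n (by omega), ← hsum, ← hprod]
      simp only [smul_eq_mul]
      ring

variable (r : Γ →* Matrix (Fin 2) (Fin 2) ℂ)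

theorem map_pow_natCard (g : Γ) : r g ^ Nat.card Γ = 1 := by
  rw [← map_pow, pow_card_eq_one', map_one]

/-- With `N` the group order, `g⁻¹ = g ^ (N - 1)`, and `ζ ^ (N - 1)` is the conjugate of `ζ`. -/
theorem trace_inv_eq_conj [Finite Γ] (g : Γ) : (r g⁻¹).trace = starRingEnd ℂ (r g).trace := by
  have hN : NeZero (Nat.card Γ) := ⟨Nat.card_pos.ne'⟩
  obtain ⟨a, b, -, h⟩ := exists_trace_pow_eq (Complex.isPrimitiveRoot_exp _ hN.out) (r g)
    (map_pow_natCard r g)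
  set ζ := Complex.exp (2 * Real.pi * Complex.I / (Nat.card Γ : ℕ)) with hζdef
  have hζ : IsPrimitiveRoot ζ (Nat.card Γ) := Complex.isPrimitiveRoot_exp _ hN.out
  have hinv : g⁻¹ = g ^ (Nat.card Γ - 1) := by
    rw [inv_eq_iff_mul_eq_one, ← pow_succ', Nat.sub_add_cancel Nat.card_pos, pow_card_eq_one']
  have hconj : ζ ^ (Nat.card Γ - 1) = starRingEnd ℂ ζ := by
    have h1 : ζ ^ (Nat.card Γ - 1) * ζ = 1 := by
      rw [← pow_succ, Nat.sub_add_cancel Nat.card_pos, hζ.pow_eq_one]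
    rw [← Complex.inv_eq_conj (hζ.norm'_eq_one hN.out)]
    exact eq_inv_of_mul_eq_one_left h1
  rw [hinv, map_pow, h, hconj, ← pow_one (r g), h, pow_one]
  simp

theorem norm_trace_sq [Finite Γ] (g : Γ) : ((‖(r g).trace‖ ^ 2 : ℝ) : ℂ) = (r g).trace * (r g⁻¹).trace := by
  rw [trace_inv_eq_conj, Complex.mul_conj, Complex.normSq_eq_norm_sq]

/-- The adjugate of a 2 × 2 matrix has the same trace as the matrix. -/
theorem trace_eq_det_mul_trace_inv (g : Γ) : (r g).trace = (r g).det * (r g⁻¹).trace := by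
  have h : r g * r g⁻¹ = 1 := by rw [← map_mul, mul_inv_cancel, map_one]
  have h2 : r g⁻¹ = (r g)⁻¹ := (Matrix.inv_eq_right_inv h).symm
  have h3 : (r g).det ≠ 0 := fun h0 => by
    have := congrArg Matrix.det h
    rw [Matrix.det_mul, h0, zero_mul, Matrix.det_one] at this
    exact zero_ne_one this
  rw [h2, Matrix.inv_def, Matrix.trace_smul, smul_eq_mul, ← mul_assoc, Ring.mul_inverse_cancel _
    (isUnit_iff_ne_zero.2 h3), one_mul, Matrix.adjugate_fin_two]
  simp [Matrix.trace, Fin.sum_univ_two, add_comm]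

theorem sum_norm_trace_sq [Fintype Γ]
    (hr : ∀ X, (∀ g, Commute X (r g)) → ∃ c : ℂ, X = c • 1) :
    ∑ g, ‖(r g).trace‖ ^ 2 = Fintype.card Γ := by
  have h := sum_trace_mul_trace_inv r hr
  rw [Finset.sum_congr rfl fun g _ => (norm_trace_sq r g).symm] at h
  exact_mod_cast h

open Polynomial in
/-- On a set of group elements stable under powers prime to the group order, where the character
does not vanish and has mean square one, the character has absolute value one. -/
theorem norm_trace_eq_one_of_sum_eq_card [Finite Γ] (S : Finset Γ)
    (hS : ∀ g ∈ S, ∀ j : ℕ, j.Coprime (Nat.card Γ) → g ^ j ∈ S)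
    (hne : ∀ g ∈ S, (r g).trace ≠ 0) (hsum : ∑ g ∈ S, ‖(r g).trace‖ ^ 2 = S.card) :
    ∀ g ∈ S, ‖(r g).trace‖ = 1 := by
  have hN : NeZero (Nat.card Γ) := ⟨Nat.card_pos.ne'⟩
  have hζ := Complex.isPrimitiveRoot_exp _ hN.out
  choose a b _ hab using fun g => exists_trace_pow_eq hζ (r g) (map_pow_natCard r g)
  have h1 := one_le_norm_of_eval_primitiveRoots hζ (∏ g ∈ S, (X ^ a g + X ^ b g))
    (∏ g ∈ S, (r g).trace) (Finset.prod_ne_zero_iff.2 hne) fun j hj => by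
      rw [map_prod]
      simp only [map_add, map_pow, aeval_X, ← hab]
      -- Replacing `ζ` by `ζ ^ j` replaces `g` by `g ^ j`, which permutes `S` because `j` is prime
      -- to the group order.
      refine Finset.prod_bij (fun g _ => g ^ j) (fun g hg => hS g hg j hj) ?_ ?_ ?_
      · intro g _ h _ e
        exact (powCoprime hj.symm).injective e
      · classical
        have himg : S.image (fun g => g ^ j) = S := by
          apply Finset.eq_of_subset_of_card_le
          · intro x hx
            obtain ⟨g, hg, rfl⟩ := Finset.mem_image.1 hx
            exact hS g hg j hj
          · exact (Finset.card_image_of_injective _ (powCoprime hj.symm).injective).ge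
        intro y hy
        rw [← himg] at hy
        obtain ⟨g, hg, rfl⟩ := Finset.mem_image.1 hy
        exact ⟨g, hg, rfl⟩
      · intro g _
        rw [map_pow]
  have h2 := eq_one_of_sum_eq_card S (fun g => ‖(r g).trace‖ ^ 2)
    (fun g hg => pow_pos (norm_pos_iff.2 (hne g hg)) 2)
    (by rw [Finset.prod_pow, ← norm_prod]; exact one_le_pow₀ h1) hsum
  intro g hg
  exact (pow_eq_one_iff_of_nonneg (norm_nonneg _) two_ne_zero).1 (h2 g hg)

end

/-! ### Groups acting freely on the plane -/

section

variable {Γ : Type*} [Group Γ] {r : Γ →* Matrix (Fin 2) (Fin 2) ℂ}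

/-- In a group acting freely, an involution acts as `-1`. -/
theorem eq_one_or_map_eq_neg_one (hfix : ∀ g, (r g - 1).det = 0 → g = 1) {g : Γ}
    (hg : r g ^ 2 = 1) : g = 1 ∨ r g = -1 := by
  refine or_iff_not_imp_left.2 fun hne => ?_
  have hu : IsUnit (r g - 1) := (Matrix.isUnit_iff_isUnit_det _).2
    (isUnit_iff_ne_zero.2 fun h => hne (hfix g h))
  have h0 : (r g - 1) * (r g + 1) = 0 := by
    rw [sub_mul, mul_add, one_mul, mul_one, ← pow_two, hg]; abel
  exact eq_neg_of_add_eq_zero_left (hu.mul_right_eq_zero.1 h0)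

/-- The square is `±1`. If it is `1`, then `r g = ±1`; if it is `-1`, Cayley–Hamilton leaves trace
zero with determinant 1, or a scalar matrix. -/
theorem det_map_eq_one_of_sq_scalar (hfix : ∀ g, (r g - 1).det = 0 → g = 1)
    (hsc : ∀ g, ∀ c : ℂ, r g = c • 1 → r g = 1 ∨ r g = -1) {g : Γ} {c : ℂ}
    (hg : r g ^ 2 = c • 1) : (r g).det = 1 := by
  have hneg : ∀ M : Matrix (Fin 2) (Fin 2) ℂ, M = 1 ∨ M = -1 → M.det = 1 := by
    rintro M (rfl | rfl) <;> simp [Matrix.det_neg]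
  have h := hsc (g ^ 2) c (by rw [map_pow, hg])
  rw [map_pow] at h
  rcases h with h | h
  · rcases eq_one_or_map_eq_neg_one hfix h with h | h
    · rw [h, map_one, Matrix.det_one]
    · exact hneg _ (Or.inr h)
  · rw [sq_eq_trace_smul_sub_det] at h
    by_cases ht : (r g).trace = 0
    · have := congrFun (congrFun h 0) 0
      simp [ht] at this
      exact this
    · refine hneg _ (hsc g (((r g).det - 1) / (r g).trace) ?_)
      have h2 : (r g).trace • r g = ((r g).det - 1) • 1 := by
        rw [sub_smul, one_smul, sub_eq_add_neg ((r g).det • _), ← h]; abel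
      rw [div_eq_inv_mul, mul_smul, ← h2, smul_smul, inv_mul_cancel₀ ht, one_smul]

/-- Let a group act freely on the nonzero vectors of the plane, with no scalars besides `±1`. If its
elements of determinant one commute, then the group is commutative or of determinant one. -/
theorem commute_of_commute_det_one (hfix : ∀ g, (r g - 1).det = 0 → g = 1)
    (hsc : ∀ g, ∀ c : ℂ, r g = c • 1 → r g = 1 ∨ r g = -1)
    (hcomm : ∀ g h, (r g).det = 1 → (r h).det = 1 → Commute (r g) (r h)) :
    (∀ g h, Commute (r g) (r h)) ∨ ∀ g, (r g).det = 1 := by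
  have inv : ∀ g, r g * r g⁻¹ = 1 := fun g => by rw [← map_mul, mul_inv_cancel, map_one]
  have inv' : ∀ g, r g⁻¹ * r g = 1 := fun g => by rw [← map_mul, inv_mul_cancel, map_one]
  have hdet : ∀ g, (r g).det * (r g⁻¹).det = 1 := fun g => by
    rw [← Matrix.det_mul, inv, Matrix.det_one]
  -- When `det x ≠ 1`, the matrix of `x ^ 2` is not scalar, so its commutant is commutative and
  -- contains `x`.
  have hsq : ∀ x h, (r x).det ≠ 1 → Commute (r x ^ 2) (r h) → Commute (r x) (r h) :=
    fun x h hx hc => by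
      by_cases hX : ∀ c : ℂ, r x ^ 2 ≠ c • 1
      · exact commute_of_commute_nonscalar hX ((Commute.refl _).pow_left 2) hc
      · push Not at hX
        obtain ⟨c, hc⟩ := hX
        exact absurd (det_map_eq_one_of_sq_scalar hfix hsc hc) hx
  have hcen : ∀ x h, (r x).det ≠ 1 → (r h).det = 1 → Commute (r x) (r h) := fun x h hx hh => by
    by_contra hne
    have hydet : (r (x * h * x⁻¹)).det = 1 := by
      rw [map_mul, map_mul, Matrix.det_mul, Matrix.det_mul, hh, mul_one, hdet]
    have hyh : Commute (r (x * h * x⁻¹)) (r h) := hcomm _ _ hydet hh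
    have htr : (r (x * h * x⁻¹)).trace = (r h).trace := by
      rw [map_mul, map_mul, Matrix.trace_mul_comm, ← mul_assoc, inv', one_mul]
    have hxh : r (x * h * x⁻¹) * r x = r x * r h := by
      rw [← map_mul, ← map_mul, inv_mul_cancel_right]
    set y := x * h * x⁻¹
    have hny : y * h⁻¹ ≠ 1 := fun e => by
      rw [mul_inv_eq_one.1 e] at hxh
      exact hne hxh.symm
    have hu : IsUnit (r (y * h⁻¹) - 1) := (Matrix.isUnit_iff_isUnit_det _).2
      (isUnit_iff_ne_zero.2 fun h' => hny (hfix _ h'))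
    have hy2 := sq_eq_trace_smul_sub_det (r y)
    have hh2 := sq_eq_trace_smul_sub_det (r h)
    rw [hydet, htr, one_smul] at hy2
    rw [hh, one_smul] at hh2
    have hsum : (r h).trace • (1 : Matrix (Fin 2) (Fin 2) ℂ) = r h + r h⁻¹ := by
      have := congrArg (· * r h⁻¹) hh2
      simp only [pow_two, sub_mul, mul_assoc, smul_mul_assoc, inv, mul_one, one_mul] at this
      exact sub_eq_iff_eq_add.1 this.symm
    -- `y` and `h` commute and share trace and determinant 1, so `(y - h)(y - h⁻¹) = 0`. Freeness
    -- cancels the first factor; conjugation by `x` thus inverts `h`, and `x ^ 2` commutes with `h`.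
    have h0 : (r (y * h⁻¹) - 1) * (r h * (r y - r h⁻¹)) = 0 := by
      have e1 : (r (y * h⁻¹) - 1) * r h = r y - r h := by
        rw [sub_mul, ← map_mul, inv_mul_cancel_right, one_mul]
      rw [← mul_assoc, e1, sub_mul, mul_sub, mul_sub, ← pow_two, hy2, inv, ← smul_one_mul, hsum,
        add_mul]
      have e2 : r h⁻¹ * r y = r y * r h⁻¹ := by
        calc r h⁻¹ * r y = r h⁻¹ * (r y * r h) * r h⁻¹ := by rw [mul_assoc, mul_assoc, inv, mul_one]
          _ = r y * r h⁻¹ := by rw [hyh.eq, ← mul_assoc, inv', one_mul]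
      rw [e2]; abel
    have h1 := hu.mul_right_eq_zero.1 h0
    have hyinv : r y = r h⁻¹ := by
      have := congrArg (r h⁻¹ * ·) h1
      simp only [← mul_assoc, inv', one_mul, mul_zero] at this
      exact sub_eq_zero.1 this
    have hxi : r x * r h⁻¹ = r h * r x := by
      have e3 : r h * (r h⁻¹ * r x) * r h⁻¹ = r h * (r x * r h) * r h⁻¹ := by
        rw [← hyinv, hxh]
      rw [← mul_assoc, inv, one_mul, mul_assoc, mul_assoc, inv, mul_one] at e3
      exact e3
    refine hne (hsq x h hx ?_)
    rw [commute_iff_eq, pow_two, mul_assoc, ← hxh, hyinv, ← mul_assoc, hxi, mul_assoc]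
  by_cases hH : ∀ h, (r h).det = 1 → ∃ c : ℂ, r h = c • 1
  · refine Or.inl fun a b => ?_
    have hs : ∀ (c : ℂ) (Y : Matrix (Fin 2) (Fin 2) ℂ), Commute (c • 1) Y := fun c Y =>
      (Commute.one_left Y).smul_left c
    by_cases hb : (r b).det = 1
    · obtain ⟨c, hc⟩ := hH b hb
      rw [hc]
      exact (hs c _).symm
    have hc1 : (r (a * b * a⁻¹ * b⁻¹)).det = 1 := by
      simp only [map_mul, Matrix.det_mul]
      linear_combination (r b).det * (r b⁻¹).det * hdet a + hdet b
    obtain ⟨c, hc⟩ := hH _ hc1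
    have hab : r a * r b = r (a * b * a⁻¹ * b⁻¹) * (r b * r a) := by
      simp only [← map_mul]; congr 1; group
    -- The commutator of `a` and `b` is `±1`, so `a` commutes with `b ^ 2`.
    refine (hsq b a hb ?_).symm
    rcases hsc _ c hc with h1 | h1
    · rw [h1, one_mul] at hab
      exact (Commute.symm hab).pow_left 2
    · rw [h1, neg_one_mul] at hab
      rw [commute_iff_eq, pow_two, mul_assoc, ← mul_assoc (r a), hab, neg_mul, mul_assoc, hab,
        mul_neg, neg_neg]
  · push Not at hH
    obtain ⟨h, hh, hh'⟩ := hH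
    have hall : ∀ x, Commute (r h) (r x) := fun x => by
      by_cases hx : (r x).det = 1
      · exact hcomm h x hh hx
      · exact (hcen x h hx hh).symm
    exact Or.inl fun a b => commute_of_commute_nonscalar hh' (hall a) (hall b)

/-- The order of the determinant divides the group order, hence is prime to `j`. -/
theorem det_map_pow_ne_one {g : Γ} (hg : (r g).det ≠ 1) {j : ℕ} (hj : j.Coprime (Nat.card Γ)) :
    (r (g ^ j)).det ≠ 1 := by
  rw [map_pow, Matrix.det_pow]
  intro h
  have hN : (r g).det ^ Nat.card Γ = 1 := by
    rw [← Matrix.det_pow, map_pow_natCard, Matrix.det_one]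
  have := Nat.dvd_gcd (orderOf_dvd_of_pow_eq_one h) (orderOf_dvd_of_pow_eq_one hN)
  rw [hj.gcd_eq_one, Nat.dvd_one, orderOf_eq_one_iff] at this
  exact hg this

/-- A finite group acting freely on the nonzero vectors of the plane, with no scalars besides `±1`,
is commutative or of determinant one. -/
theorem commute_or_det_eq_one [Finite Γ] (hfix : ∀ g, (r g - 1).det = 0 → g = 1)
    (hsc : ∀ g, ∀ c : ℂ, r g = c • 1 → r g = 1 ∨ r g = -1) :
    (∀ g h, Commute (r g) (r h)) ∨ ∀ g, (r g).det = 1 := by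
  classical
  have : Fintype Γ := Fintype.ofFinite Γ
  let K : Subgroup Γ := ((Matrix.detMonoidHom).comp r).ker
  have hK : ∀ g, g ∈ K ↔ (r g).det = 1 := fun g => MonoidHom.mem_ker
  by_cases hI : ∀ X, (∀ g : K, Commute X ((r.comp K.subtype) g)) → ∃ c : ℂ, X = c • 1
  · right
    have hsumK := sum_norm_trace_sq (r.comp K.subtype) hI
    -- Both `K` and the whole group act irreducibly; subtracting the two orthogonality relations
    -- gives mean square 1 outside `K`.
    have hsum := sum_norm_trace_sq r fun X hX => hI X fun g => hX g
    let S : Finset Γ := Finset.univ.filter (· ∉ K)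
    have h1 : ∑ g ∈ S, ‖(r g).trace‖ ^ 2 = S.card := by
      have e1 := Finset.sum_filter_add_sum_filter_not Finset.univ (· ∈ K)
        fun g => ‖(r g).trace‖ ^ 2
      have e2 : ∑ g ∈ Finset.univ.filter (· ∈ K), ‖(r g).trace‖ ^ 2 = Fintype.card K := by
        rw [← hsumK]
        exact Finset.sum_subtype _ (by simp) _
      have e3 : (Fintype.card K : ℝ) + S.card = Fintype.card Γ := by
        have := Finset.card_filter_add_card_filter_not (s := (Finset.univ : Finset Γ)) (· ∈ K)
        rw [Fintype.card_subtype]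
        exact_mod_cast this
      rw [e2, hsum] at e1
      linarith
    have h2 := norm_trace_eq_one_of_sum_eq_card r S
      (fun g hg j hj => by
        simp only [S, Finset.mem_filter, Finset.mem_univ, true_and, hK] at hg ⊢
        exact det_map_pow_ne_one hg hj)
      (fun g hg ht => by
        simp only [S, Finset.mem_filter, Finset.mem_univ, true_and, hK] at hg
        refine hg (det_map_eq_one_of_sq_scalar hfix hsc (c := -(r g).det) ?_)
        rw [sq_eq_trace_smul_sub_det, ht, zero_smul, zero_sub, neg_smul]) h1
    intro g
    by_contra hg
    have hn := h2 g (by simpa [S, hK] using hg)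
    have ht2 : (r g).trace ^ 2 = (r g).det := by
      have e1 := norm_trace_sq r g
      rw [hn] at e1
      have e2 := trace_eq_det_mul_trace_inv r g
      push_cast at e1
      linear_combination (r g).trace * e2 - (r g).det * e1
    set t := (r g).trace
    -- The characteristic polynomial is `X² - tX + t²`, a factor of `X³ + t³`; so `g ^ 3` is scalar
    -- and `t ^ 3 = ±1`.
    have h3 : r g ^ 3 = (-t ^ 3) • 1 := by
      rw [pow_succ, sq_eq_trace_smul_sub_det, sub_mul, smul_mul_assoc, ← pow_two,
        sq_eq_trace_smul_sub_det, ← ht2, smul_sub, smul_smul, smul_smul, smul_mul_assoc, one_mul,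
        ← pow_two, neg_smul, pow_succ' t 2]
      abel
    have hdet1 := det_sub_one_eq (r g)
    have hdet2 : (-r g - 1).det = 1 + t + t ^ 2 := by
      rw [det_sub_one_eq, Matrix.trace_neg, Matrix.det_neg, ht2]
      simp [t]
    rw [← ht2] at hdet1
    have hcase := hsc (g ^ 3) _ (by rw [map_pow, h3])
    rw [map_pow, h3] at hcase
    have hcube : t ^ 3 = -1 ∨ t ^ 3 = 1 := by
      rcases hcase with h | h
      · left
        have := congrFun (congrFun h 0) 0
        simp at this
        linear_combination -this
      · right
        have := congrFun (congrFun h 0) 0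
        simpa using this
    have hne1 : t ≠ 1 := fun h => hg (by rw [← ht2, h, one_pow])
    have hne2 : t ≠ -1 := fun h => hg (by rw [← ht2, h]; norm_num)
    rcases hcube with h | h
    · have h0 : 1 - t + t ^ 2 = 0 := by
        have : (t + 1) * (1 - t + t ^ 2) = 0 := by linear_combination h
        exact (mul_eq_zero.1 this).resolve_left fun h' => hne2 (eq_neg_of_add_eq_zero_left h')
      refine hg ?_
      rw [hfix g (hdet1.trans h0), map_one, Matrix.det_one]
    · have h0 : 1 + t + t ^ 2 = 0 := by
        have : (t - 1) * (1 + t + t ^ 2) = 0 := by linear_combination h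
        exact (mul_eq_zero.1 this).resolve_left fun h' => hne1 (sub_eq_zero.1 h')
      -- Here `-1` is an eigenvalue of `g` and `g ^ 3` acts as `-1`, so `g ^ 4` acts as `-g` and
      -- fixes a nonzero vector.
      have hr3 : r (g ^ 3) = -1 := by rw [map_pow, h3, h, neg_smul, one_smul]
      have hr4 : r (g * g ^ 3) = -r g := by rw [map_mul, hr3, mul_neg, mul_one]
      have h5 := hfix (g * g ^ 3) (by rw [hr4, hdet2, h0])
      rw [h5, map_one] at hr4
      refine hg ?_
      rw [← neg_eq_iff_eq_neg.2 hr4]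
      simp [Matrix.det_neg]
  · refine commute_of_commute_det_one hfix hsc fun g h hg hh => ?_
    exact commute_of_nonscalar_commutant _ hI ⟨g, (hK g).2 hg⟩ ⟨h, (hK h).2 hh⟩

/-- A finite group acting freely on the nonzero vectors of the plane and not containing `-1` is
commutative. -/
theorem commute_of_map_ne_neg_one [Finite Γ] (hfix : ∀ g, (r g - 1).det = 0 → g = 1)
    (hneg : ∀ g, r g ≠ -1) (g h : Γ) : Commute (r g) (r h) := by
  classical
  have : Fintype Γ := Fintype.ofFinite Γ
  refine commute_of_nonscalar_commutant r (fun hI => ?_) g h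
  have hodd : ¬ 2 ∣ Nat.card Γ := fun hdvd => by
    obtain ⟨x, hx⟩ := exists_prime_orderOf_dvd_card' 2 hdvd
    have hx2 : r x ^ 2 = 1 := by
      rw [← map_pow, orderOf_dvd_iff_pow_eq_one.1 hx.dvd, map_one]
    rcases eq_one_or_map_eq_neg_one hfix hx2 with h | h
    · rw [h, orderOf_one] at hx
      omega
    · exact hneg x h
  have htr : ∀ x, (r x).trace ≠ 0 := fun x hx => by
    have h2 : r x ^ 2 = (-(r x).det) • 1 := by
      rw [sq_eq_trace_smul_sub_det, hx, zero_smul, zero_sub, neg_smul]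
    -- In odd order `g` is a power of `g ^ 2`, so trace zero would make `g` a scalar of trace zero,
    -- hence zero.
    obtain ⟨k, hk⟩ : ∃ k, Nat.card Γ + 1 = 2 * k := ⟨(Nat.card Γ + 1) / 2, by omega⟩
    have h3 : r x = (-(r x).det) ^ k • 1 := by
      calc r x = r x ^ (Nat.card Γ + 1) := by rw [pow_succ, map_pow_natCard, one_mul]
        _ = (-(r x).det) ^ k • 1 := by rw [hk, pow_mul, h2, smul_pow, one_pow]
    set c := (-(r x).det) ^ k
    rw [h3] at hx
    have hc : c = 0 := by simpa using hx
    have h4 := map_pow_natCard r x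
    rw [h3, hc, zero_smul, zero_pow Nat.card_pos.ne'] at h4
    exact zero_ne_one h4
  have h1 := norm_trace_eq_one_of_sum_eq_card r Finset.univ (fun _ _ _ _ => Finset.mem_univ _)
    (fun g _ => htr g) (by rw [sum_norm_trace_sq r hI, Finset.card_univ]) 1 (Finset.mem_univ _)
  rw [map_one, Matrix.trace_one] at h1
  norm_num at h1

end

/-! ### Small matrix groups and the action of central elements -/

section

variable {n : ℕ} (G : Subgroup (GL (Fin n) ℂ))

/-- The inclusion of a matrix group into the algebra of matrices. -/
def matrixHom : G →* Matrix (Fin n) (Fin n) ℂ :=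
  (Units.coeHom (Matrix (Fin n) (Fin n) ℂ)).comp G.subtype

theorem naturalRep_apply (g : G) (w : Fin n → ℂ) :
    naturalRep G g w = (matrixHom G g).mulVec w := rfl

theorem detRep_naturalRep_apply (g : G) (c : ℂ) :
    detRep (naturalRep G) g c = (matrixHom G g).det * c := by
  change (LinearMap.det (Matrix.toLin' (matrixHom G g)) • LinearMap.id) c = _
  rw [LinearMap.det_toLin']
  rfl

theorem matrixHom_injective : Function.Injective (matrixHom G) := fun _ _ h =>
  Subtype.ext (Units.ext h)

theorem le_range_toGL_of_det_eq_one (h : ∀ g, (matrixHom G g).det = 1) :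
    G ≤ (Matrix.SpecialLinearGroup.toGL (n := Fin n) (R := ℂ)).range := fun g hg =>
  ⟨⟨(g : Matrix (Fin n) (Fin n) ℂ), h ⟨g, hg⟩⟩, Units.ext rfl⟩

theorem det_matrixHom_ne_zero (g : G) : (matrixHom G g).det ≠ 0 := by
  have h : matrixHom G g * matrixHom G g⁻¹ = 1 := by rw [← map_mul, mul_inv_cancel, map_one]
  intro h0
  have := congrArg Matrix.det h
  rw [Matrix.det_mul, h0, zero_mul, Matrix.det_one] at this
  exact zero_ne_one this

end

/-- A finite small subgroup of `GL₂(ℂ)` acts freely on the nonzero vectors. -/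
theorem eq_one_of_det_sub_one_eq_zero {G : Subgroup (GL (Fin 2) ℂ)} [Finite G] (hG : IsSmall G)
    (g : G) (hg : (matrixHom G g - 1).det = 0) : g = 1 := by
  have hfin : IsOfFinOrder (g : GL (Fin 2) ℂ) :=
    MonoidHom.isOfFinOrder G.subtype (isOfFinOrder_of_finite g)
  have h1 : (matrixHom G g - 1).rank ≠ 1 := fun h => hG g g.2 ⟨hfin, h⟩
  have h2 : (matrixHom G g - 1).rank ≠ 2 := fun h => by
    have hr : LinearMap.range (matrixHom G g - 1).mulVecLin = ⊤ := by
      apply Submodule.eq_top_of_finrank_eq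
      rw [Module.finrank_fin_fun]
      exact h
    have hinj := LinearMap.injective_iff_surjective.2 (LinearMap.range_eq_top.1 hr)
    obtain ⟨v, hv, hv'⟩ := Matrix.exists_mulVec_eq_zero_iff.2 hg
    exact hv (hinj (by rw [Matrix.mulVecLin_apply, hv', map_zero]))
  have h3 : (matrixHom G g - 1).rank ≤ 2 := by
    simpa using (matrixHom G g - 1).rank_le_card_height
  have h0 : matrixHom G g - 1 = 0 := by
    have hr : LinearMap.range (matrixHom G g - 1).mulVecLin = ⊥ :=
      Submodule.finrank_eq_zero.1 (by change (matrixHom G g - 1).rank = 0; omega)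
    apply Matrix.toLin'.injective
    rw [map_zero]
    exact LinearMap.range_eq_bot.1 hr
  apply matrixHom_injective
  rw [sub_eq_zero.1 h0, map_one]

section

variable {Γ : Type*} [Group Γ]

theorem Irrep.nontrivial (A : Irrep Γ) : Nontrivial A.V := by
  have := A.irreducible
  by_contra h
  rw [not_nontrivial_iff_subsingleton] at h
  exact bot_ne_top (α := Subrepresentation A.ρ) (Subrepresentation.toSubmodule_injective
    (Subsingleton.elim _ _))

/-- A central element acts on an irreducible representation as a scalar. -/
theorem Irrep.exists_eq_smul (A : Irrep Γ) (g : Γ) (hg : ∀ h, Commute g h) :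
    ∃ c : ℂ, c ≠ 0 ∧ ∀ v, A.ρ g v = c • v := by
  have := A.irreducible
  let f : A.ρ.IntertwiningMap A.ρ := .centralMul A.ρ g (Submonoid.mem_center_iff.2 fun h =>
    (hg h).eq.symm)
  obtain ⟨c, hc⟩ :=
    (Representation.IsIrreducible.algebraMap_intertwiningMap_bijective_of_isAlgClosed (k := ℂ)
      (ρ := A.ρ)).2 f
  have hv : ∀ v, A.ρ g v = c • v := fun v => by
    have := congrArg (fun φ : A.ρ.IntertwiningMap A.ρ => φ v) hc
    exact this.symm
  refine ⟨c, ?_, hv⟩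
  rintro rfl
  have := A.nontrivial
  obtain ⟨v, hv0⟩ := exists_ne (0 : A.V)
  have h1 : A.ρ g⁻¹ (A.ρ g v) = v := by
    rw [← Module.End.mul_apply, ← map_mul, inv_mul_cancel, map_one, Module.End.one_apply]
  rw [hv, zero_smul, map_zero] at h1
  exact hv0 h1.symm

theorem detRep_tprod_apply_of_central {G : Subgroup (GL (Fin 2) ℂ)} {V : Type*} [AddCommGroup V]
    [Module ℂ V] (ρ : Representation ℂ G V) {g : G} {c : ℂ} (hc : ∀ v, ρ g v = c • v)
    (x : ℂ ⊗[ℂ] V) :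
    ((detRep (naturalRep G)).tprod ρ) g x = ((matrixHom G g).det * c) • x := by
  induction x using TensorProduct.induction_on with
  | zero => simp
  | tmul a v =>
    rw [Representation.tprod_apply, TensorProduct.map_tmul, detRep_naturalRep_apply, hc,
      TensorProduct.tmul_smul, ← smul_eq_mul, ← TensorProduct.smul_tmul', smul_smul, mul_comm]
  | add x y hx hy => rw [map_add, hx, hy, smul_add]

theorem twist_apply_of_central {G : Subgroup (GL (Fin 2) ℂ)} (A : Irrep G) {g : G} {c : ℂ}
    (hc : ∀ v, A.ρ g v = c • v) (x : (A.twist (detRep (naturalRep G))).V) :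
    (A.twist (detRep (naturalRep G))).ρ g x = ((matrixHom G g).det * c) • x :=
  detRep_tprod_apply_of_central A.ρ hc x

end

/-! ### No path of length 0 or 1 -/

section

variable {G : Subgroup (GL (Fin 2) ℂ)}

theorem det_eq_one_of_equiv_twist (A : Irrep G)
    (e : A.ρ.Equiv (A.twist (detRep (naturalRep G))).ρ) (g : G) (hg : ∀ h, Commute g h) :
    (matrixHom G g).det = 1 := by
  obtain ⟨c, hc0, hc⟩ := A.exists_eq_smul g hg
  have := A.nontrivial
  obtain ⟨v, hv0⟩ := exists_ne (0 : A.V)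
  have h1 : e (A.ρ g v) = (A.twist (detRep (naturalRep G))).ρ g (e v) :=
    Representation.IntertwiningMap.isIntertwining _ _ e.toIntertwiningMap g v
  have h2 : c • e v = ((matrixHom G g).det * c) • e v := by
    rw [← twist_apply_of_central A hc (e v), ← h1, hc]
    exact (map_smul e.toLinearEquiv c v).symm
  have hev : e v ≠ 0 := fun h => hv0 (e.toLinearEquiv.map_eq_zero_iff.1 h)
  have h3 := smul_left_injective ℂ hev h2
  exact mul_right_cancel₀ hc0 (by rw [one_mul]; exact h3.symm)

theorem not_nonempty_equiv_twist [Finite G] (hG : IsSmall G)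
    (hSL : ¬ G ≤ (Matrix.SpecialLinearGroup.toGL (n := Fin 2) (R := ℂ)).range) (A : Irrep G) :
    ¬ Nonempty (A.ρ.Equiv (A.twist (detRep (naturalRep G))).ρ) := by
  rintro ⟨e⟩
  refine hSL (le_range_toGL_of_det_eq_one G ?_)
  have hsc : ∀ g, ∀ c : ℂ, matrixHom G g = c • 1 → matrixHom G g = 1 ∨ matrixHom G g = -1 := by
    intro g c hc
    have hcen : ∀ h, Commute g h := fun h => matrixHom_injective G (by
      rw [map_mul, map_mul, hc, smul_one_mul, mul_smul_one])
    have hd := det_eq_one_of_equiv_twist A e g hcen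
    rw [hc, Matrix.det_smul, Matrix.det_one, mul_one, Fintype.card_fin] at hd
    rcases mul_self_eq_one_iff.1 ((pow_two c).symm.trans hd) with rfl | rfl
    · left; rw [hc, one_smul]
    · right; rw [hc, neg_smul, one_smul]
  rcases commute_or_det_eq_one (eq_one_of_det_sub_one_eq_zero hG) hsc with h | h
  · exact fun g => det_eq_one_of_equiv_twist A e g fun h' => matrixHom_injective G (by
      rw [map_mul, map_mul, (h g h').eq])
  · exact h

theorem map_tmul_naturalRep (A : Irrep G)
    (φ : (A.ρ.tprod (naturalRep G)).IntertwiningMap (A.twist (detRep (naturalRep G))).ρ)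
    (g : G) (hg : ∀ h, Commute g h) (a : A.V) (w : Fin 2 → ℂ) :
    φ (a ⊗ₜ (matrixHom G g).mulVec w) = (matrixHom G g).det • φ (a ⊗ₜ w) := by
  obtain ⟨c, hc0, hc⟩ := A.exists_eq_smul g hg
  have h := Representation.IntertwiningMap.isIntertwining _ _ φ g (a ⊗ₜ w)
  rw [Representation.tprod_apply, TensorProduct.map_tmul, hc, twist_apply_of_central A hc,
    naturalRep_apply, ← TensorProduct.smul_tmul', map_smul, mul_comm, mul_smul] at h
  exact smul_right_injective _ hc0 h

theorem intertwiningMap_twist_eq_zero [Finite G] (hG : IsSmall G)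
    (hSL : ¬ G ≤ (Matrix.SpecialLinearGroup.toGL (n := Fin 2) (R := ℂ)).range) (A : Irrep G)
    (φ : (A.ρ.tprod (naturalRep G)).IntertwiningMap (A.twist (detRep (naturalRep G))).ρ) :
    φ = 0 := by
  have hfix := eq_one_of_det_sub_one_eq_zero hG
  suffices h : ∀ a w, φ (a ⊗ₜ w) = 0 by
    apply Representation.IntertwiningMap.toLinearMap_injective
    apply TensorProduct.ext'
    intro a w
    exact h a w
  by_cases hneg : ∃ g, matrixHom G g = -1
  · obtain ⟨g, hg⟩ := hneg
    intro a w
    have h := map_tmul_naturalRep A φ g (fun h => matrixHom_injective G (by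
      rw [map_mul, map_mul, hg, neg_one_mul, mul_neg_one])) a w
    rw [hg, Matrix.neg_mulVec, Matrix.one_mulVec, TensorProduct.tmul_neg, map_neg,
      Matrix.det_neg, Matrix.det_one, Fintype.card_fin, mul_one, neg_one_sq, one_smul] at h
    have h2 : (2 : ℂ) • φ (a ⊗ₜ w) = 0 := by
      rw [two_smul]; nth_rewrite 1 [← h]; exact neg_add_cancel _
    exact (smul_eq_zero.1 h2).resolve_left two_ne_zero
  · push Not at hneg
    have hcomm := commute_of_map_ne_neg_one hfix hneg
    have hcen : ∀ g h : G, Commute g h := fun g h => matrixHom_injective G (by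
      rw [map_mul, map_mul, (hcomm g h).eq])
    by_contra! hne
    obtain ⟨a, w, haw⟩ := hne
    refine hSL (le_range_toGL_of_det_eq_one G fun g => ?_)
    set M := matrixHom G g with hM
    -- `φ (a ⊗ₜ ·)` kills the range of `M - det M`, so this matrix cannot be surjective when `φ (a
    -- ⊗ₜ w) ≠ 0`.
    have hdet : (M - M.det • 1).det = 0 := by
      by_contra h0
      have hu : IsUnit (M - M.det • 1) := (Matrix.isUnit_iff_isUnit_det _).2
        (isUnit_iff_ne_zero.2 h0)
      obtain ⟨w', hw'⟩ := Matrix.mulVec_surjective_iff_isUnit.2 hu w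
      apply haw
      rw [← hw', Matrix.sub_mulVec, Matrix.smul_mulVec, Matrix.one_mulVec, TensorProduct.tmul_sub,
        map_sub, map_tmul_naturalRep A φ g (hcen g), TensorProduct.tmul_smul, map_smul, sub_self]
    have hd0 : M.det ≠ 0 := det_matrixHom_ne_zero G g
    -- The eigenvalues multiply to `det M`, so if one of them is `det M` the other is 1; as an
    -- identity, `det (M - det M) = det M * det (M - 1)`.
    have h1 : (M - 1).det = 0 := by
      apply mul_left_cancel₀ hd0
      rw [mul_zero, ← hdet, det_sub_one_eq]
      simp only [Matrix.det_fin_two, Matrix.trace_fin_two, Matrix.sub_apply, Matrix.smul_apply,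
        Matrix.one_apply_eq, smul_eq_mul]
      simp
      ring
    rw [hM, hfix g h1, map_one, Matrix.det_one]

end

/-! ### Irreducible constituents and maps through them -/

section

variable {G U V W X : Type*} [Group G] [AddCommGroup U] [Module ℂ U] [AddCommGroup V] [Module ℂ V]
  [AddCommGroup W] [Module ℂ W] [AddCommGroup X] [Module ℂ X]

/-- An atom in the lattice of subrepresentations is irreducible. -/
theorem isIrreducible_of_isAtom {τ : Representation ℂ G V} {S : Subrepresentation τ}
    (hS : IsAtom S) : S.toRepresentation.IsIrreducible where
  exists_pair_ne := ⟨⊥, ⊤, fun h => hS.1 (by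
    apply Subrepresentation.toSubmodule_injective
    have h' : (⊥ : Submodule ℂ S.toSubmodule) = ⊤ := congrArg Subrepresentation.toSubmodule h
    refine (Submodule.eq_bot_iff _).2 fun x hx => ?_
    have : (⟨x, hx⟩ : S.toSubmodule) ∈ (⊥ : Submodule ℂ S.toSubmodule) := by rw [h']; trivial
    exact congrArg Subtype.val ((Submodule.mem_bot ℂ).1 this))⟩
  eq_bot_or_eq_top T := by
    let T' : Subrepresentation τ := ⟨T.toSubmodule.map S.toSubmodule.subtype, by
      rintro g _ ⟨x, hx, rfl⟩
      exact ⟨S.toRepresentation g x, T.apply_mem_toSubmodule g hx, rfl⟩⟩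
    have hle : T' ≤ S := by
      rintro _ ⟨x, -, rfl⟩
      exact x.2
    rcases hS.le_iff.1 hle with h | h
    · left
      apply Subrepresentation.toSubmodule_injective
      have h' : T.toSubmodule.map S.toSubmodule.subtype = ⊥ :=
        congrArg Subrepresentation.toSubmodule h
      exact Submodule.map_injective_of_injective S.toSubmodule.subtype_injective
        (h'.trans (Submodule.map_bot _).symm)
    · right
      apply Subrepresentation.toSubmodule_injective
      have h' : T.toSubmodule.map S.toSubmodule.subtype = S.toSubmodule :=
        congrArg Subrepresentation.toSubmodule h
      refine Submodule.map_injective_of_injective S.toSubmodule.subtype_injective ?_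
      rw [h']
      exact (Submodule.map_subtype_top _).symm

/-- A nonzero subrepresentation of a representation of a finite group admits a nonzero map from the
whole representation. -/
theorem exists_intertwiningMap_ne_zero [Finite G] {τ : Representation ℂ G V}
    {S : Subrepresentation τ} (hS : S ≠ ⊥) :
    ∃ p : τ.IntertwiningMap S.toRepresentation, p ≠ 0 := by
  have : Fintype G := Fintype.ofFinite G
  obtain ⟨π, hπ⟩ := S.toSubmodule.subtype.exists_leftInverse_of_injective
    S.toSubmodule.ker_subtype
  have hπ' : ∀ s : S.toSubmodule, π s = s := fun s => LinearMap.congr_fun hπ s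
  let p : τ.IntertwiningMap S.toRepresentation :=
    -- Maschke averaging of a linear projection, left unnormalised: on `S` it is multiplication by
    -- the group order.
    { toLinearMap := ∑ g, S.toRepresentation g⁻¹ ∘ₗ π ∘ₗ τ g
      isIntertwining' := fun h => by
        ext1 v
        simp only [LinearMap.comp_apply, LinearMap.sum_apply, map_sum]
        refine Fintype.sum_equiv (Equiv.mulRight h) _ _ fun g => ?_
        simp only [Equiv.coe_mulRight, mul_inv_rev, map_mul, Module.End.mul_apply]
        rw [← Module.End.mul_apply (S.toRepresentation h), ← map_mul, mul_inv_cancel, map_one,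
          Module.End.one_apply] }
  refine ⟨p, fun h => hS (Subrepresentation.toSubmodule_injective ?_)⟩
  refine (Submodule.eq_bot_iff _).2 fun x hx => ?_
  have h1 : p x = Fintype.card G • (⟨x, hx⟩ : S.toSubmodule) := by
    change (∑ g, S.toRepresentation g⁻¹ ∘ₗ π ∘ₗ τ g) x = _
    rw [LinearMap.sum_apply, ← Finset.card_univ, ← Finset.sum_const]
    refine Finset.sum_congr rfl fun g _ => ?_
    have e : τ g x = (S.toRepresentation g ⟨x, hx⟩ : S.toSubmodule) := rfl
    rw [LinearMap.comp_apply, LinearMap.comp_apply, e, hπ', ← Module.End.mul_apply, ← map_mul,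
      inv_mul_cancel, map_one, Module.End.one_apply]
  rw [h] at h1
  have h2 : Fintype.card G • (⟨x, hx⟩ : S.toSubmodule) = 0 := h1.symm
  rw [← Nat.cast_smul_eq_nsmul ℂ, smul_eq_zero] at h2
  exact congrArg Subtype.val (h2.resolve_left (Nat.cast_ne_zero.2 Fintype.card_ne_zero))

/-- A nonzero intertwining map `V ⊗ W → X` does not vanish on `S ⊗ W` for some irreducible
subrepresentation `S` of `V`. -/
theorem exists_isAtom_rTensor_ne_zero [Finite G] {τ : Representation ℂ G V}
    {ω : Representation ℂ G W} {β : Representation ℂ G X} (Φ : (τ.tprod ω).IntertwiningMap β)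
    (hΦ : Φ ≠ 0) :
    ∃ S : Subrepresentation τ, IsAtom S ∧ ∃ s ∈ S, ∃ w, Φ (s ⊗ₜ w) ≠ 0 := by
  by_contra! hall
  -- The vectors `v` with `Φ` zero on `v ⊗ W` form a subrepresentation. If it contained every
  -- irreducible one, semisimplicity would make it everything.
  let T : Subrepresentation τ :=
    { toSubmodule :=
        { carrier := {v | ∀ w, Φ (v ⊗ₜ w) = 0}
          add_mem' := fun {a b} ha hb w => by
            rw [TensorProduct.add_tmul, map_add, ha w, hb w, add_zero]
          zero_mem' := fun w => by rw [TensorProduct.zero_tmul, map_zero]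
          smul_mem' := fun c a ha w => by
            rw [← TensorProduct.smul_tmul', map_smul, ha w, smul_zero] }
      apply_mem_toSubmodule := fun g v hv w => by
        have h := Representation.IntertwiningMap.isIntertwining _ _ Φ g (v ⊗ₜ ω g⁻¹ w)
        rw [Representation.tprod_apply, TensorProduct.map_tmul, hv, map_zero,
          ← Module.End.mul_apply, ← map_mul, mul_inv_cancel, map_one, Module.End.one_apply] at h
        exact h }
  have : NeZero (Nat.card G : ℂ) := ⟨Nat.cast_ne_zero.2 Nat.card_pos.ne'⟩
  let O := Subrepresentation.subrepresentationSubmoduleOrderIso (ρ := τ)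
  have htop : O T = ⊤ := by
    rw [eq_top_iff, ← IsSemisimpleModule.sSup_simples_eq_top (MonoidAlgebra ℂ G) τ.asModule]
    refine sSup_le fun m hm => ?_
    have hm' : IsAtom m := isSimpleModule_iff_isAtom.1 hm
    have hat : IsAtom (O.symm m) := (O.symm.isAtom_iff m).2 hm'
    have hle : O.symm m ≤ T := fun s hs w => hall _ hat s hs w
    exact O.symm_apply_le.1 hle
  have hT : ∀ v w, Φ (v ⊗ₜ w) = 0 := fun v => by
    have : T = ⊤ := by rw [← map_top O] at htop; exact O.injective htop
    have hv : v ∈ T := by rw [this]; exact Submodule.mem_top (R := ℂ)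
    exact hv
  apply hΦ
  apply Representation.IntertwiningMap.toLinearMap_injective
  exact TensorProduct.ext' hT

instance [FiniteDimensional ℂ V] [FiniteDimensional ℂ W] (τ : Representation ℂ G V)
    (ω : Representation ℂ G W) : FiniteDimensional ℂ (τ.IntertwiningMap ω) :=
  FiniteDimensional.of_injective
    (Representation.IntertwiningMap.toLinearMapl τ ω)
    (Representation.IntertwiningMap.toLinearMap_injective τ ω)

theorem Irrep.mult_pos_iff [FiniteDimensional ℂ W] (ω : Representation ℂ G W) (A B : Irrep G) :
    0 < A.mult ω B ↔ ∃ φ : (A.ρ.tprod ω).IntertwiningMap B.ρ, φ ≠ 0 := by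
  rw [Irrep.mult, Module.finrank_pos_iff_exists_ne_zero]

/-- A nonzero map `A ⊗ W ⊗ W → B` factors nontrivially through an irreducible constituent of
`A ⊗ W`. -/
theorem Irrep.exists_mult_pos {W : Type} [AddCommGroup W] [Module ℂ W] [FiniteDimensional ℂ W]
    [Finite G] (ω : Representation ℂ G W) (A B : Irrep G)
    (Φ : ((A.ρ.tprod ω).tprod ω).IntertwiningMap B.ρ) (hΦ : Φ ≠ 0) :
    ∃ C : Irrep G, 0 < A.mult ω C ∧ 0 < C.mult ω B := by
  obtain ⟨S, hS, s, hs, w, hsw⟩ := exists_isAtom_rTensor_ne_zero Φ hΦ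
  refine ⟨⟨S.toSubmodule, S.toRepresentation, isIrreducible_of_isAtom hS⟩, ?_, ?_⟩
  · exact (Irrep.mult_pos_iff ω _ _).2 (exists_intertwiningMap_ne_zero hS.1)
  · let i : S.toRepresentation.IntertwiningMap (A.ρ.tprod ω) :=
      { toLinearMap := S.toSubmodule.subtype
        isIntertwining' := fun g => rfl }
    refine (Irrep.mult_pos_iff ω _ _).2 ⟨Φ.comp (i.rTensor ω), fun h => hsw ?_⟩
    have := congrArg (fun φ : (S.toRepresentation.tprod ω).IntertwiningMap B.ρ =>
      φ ((⟨s, hs⟩ : S.toSubmodule) ⊗ₜ w)) h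
    exact this

end

/-! ### The path of length 2 -/

/-- The projection of `W ⊗ W` onto its exterior square, for `W = ℂ²`. -/
def wedge (G : Subgroup (GL (Fin 2) ℂ)) :
    ((naturalRep G).tprod (naturalRep G)).IntertwiningMap (detRep (naturalRep G)) where
  toLinearMap := TensorProduct.lift (LinearMap.mk₂ ℂ
    (fun v w : Fin 2 → ℂ => v 0 * w 1 - v 1 * w 0)
    (fun _ _ _ => by simp only [Pi.add_apply]; ring)
    (fun _ _ _ => by simp only [Pi.smul_apply, smul_eq_mul]; ring)
    (fun _ _ _ => by simp only [Pi.add_apply]; ring)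
    (fun _ _ _ => by simp only [Pi.smul_apply, smul_eq_mul]; ring))
  isIntertwining' g := by
    apply TensorProduct.ext'
    intro v w
    rw [LinearMap.comp_apply, LinearMap.comp_apply, Representation.tprod_apply,
      TensorProduct.map_tmul, TensorProduct.lift.tmul, TensorProduct.lift.tmul,
      detRep_naturalRep_apply, LinearMap.mk₂_apply, LinearMap.mk₂_apply, naturalRep_apply,
      naturalRep_apply, Matrix.det_fin_two]
    simp only [Matrix.mulVec, dotProduct, Fin.sum_univ_two]
    ring

theorem wedge_tmul (G : Subgroup (GL (Fin 2) ℂ)) (v w : Fin 2 → ℂ) :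
    wedge G (v ⊗ₜ w) = v 0 * w 1 - v 1 * w 0 := rfl

/-- Reassociate, apply `wedge` to `W ⊗ W`, and swap the factors; `a ⊗ e₁ ⊗ e₂` goes to `1 ⊗ a`. -/
theorem exists_intertwiningMap_tensor_square_ne_zero {G : Subgroup (GL (Fin 2) ℂ)} (A : Irrep G) :
    ∃ Φ : ((A.ρ.tprod (naturalRep G)).tprod (naturalRep G)).IntertwiningMap
      (A.twist (detRep (naturalRep G))).ρ, Φ ≠ 0 := by
  let Φ : ((A.ρ.tprod (naturalRep G)).tprod (naturalRep G)).IntertwiningMap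
      ((detRep (naturalRep G)).tprod A.ρ) :=
    (Representation.TensorProduct.comm A.ρ (detRep (naturalRep G))).toIntertwiningMap.comp
      (((wedge G).lTensor A.ρ).comp (Representation.TensorProduct.assoc A.ρ (naturalRep G)
        (naturalRep G)).toIntertwiningMap)
  have := A.nontrivial
  obtain ⟨a, ha⟩ := exists_ne (0 : A.V)
  have hΦ : Φ ((a ⊗ₜ ![1, 0]) ⊗ₜ ![0, 1]) = (wedge G (![1, 0] ⊗ₜ ![0, 1])) ⊗ₜ a := rfl
  refine ⟨Φ, fun h => ha ?_⟩
  have h0 : Φ ((a ⊗ₜ ![1, 0]) ⊗ₜ ![0, 1]) = 0 :=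
    congrArg (fun φ : ((A.ρ.tprod (naturalRep G)).tprod (naturalRep G)).IntertwiningMap
      (A.twist (detRep (naturalRep G))).ρ => φ ((a ⊗ₜ ![1, 0]) ⊗ₜ ![0, 1])) h
  rw [hΦ, wedge_tmul] at h0
  simpa using congrArg (TensorProduct.lid ℂ A.V) h0

theorem nonempty_hom_iff {G W : Type*} [Group G] [AddCommGroup W] [Module ℂ W]
    (ω : Representation ℂ G W) (A B : Irrep G) :
    Nonempty (vertex ω A ⟶ vertex ω B) ↔ 0 < A.mult ω B :=
  Fin.pos_iff_nonempty.symm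

theorem two_le_length_of_isEmpty_hom {V : Type*} [Quiver V] {a b : V} (hne : a ≠ b)
    (hE : ¬ Nonempty (a ⟶ b)) (p : Quiver.Path a b) : 2 ≤ p.length := by
  cases p with
  | nil => exact absurd rfl hne
  | cons p e =>
    cases p with
    | nil => exact absurd ⟨e⟩ hE
    | cons p f => simp only [Quiver.Path.length_cons]; omega

end McKay

theorem mainTheorem5 (G : Subgroup (GL (Fin 2) ℂ)) [Finite G] (hsmall : McKay.IsSmall G)
    (hSL : ¬ G ≤ (Matrix.SpecialLinearGroup.toGL (n := Fin 2) (R := ℂ)).range)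
    (A : McKay.Irrep G) :
    ∃ p : Quiver.Path (McKay.vertex (McKay.naturalRep G) A)
        (McKay.vertex (McKay.naturalRep G) (A.twist (McKay.detRep (McKay.naturalRep G)))),
      (∀ q : Quiver.Path (McKay.vertex (McKay.naturalRep G) A)
        (McKay.vertex (McKay.naturalRep G) (A.twist (McKay.detRep (McKay.naturalRep G)))),
        p.length ≤ q.length) ∧ 2 ≤ p.length := by
  open McKay in
  have hne : vertex (naturalRep G) A ≠
      vertex (naturalRep G) (A.twist (detRep (naturalRep G))) := fun h =>
    not_nonempty_equiv_twist hsmall hSL A (Quotient.exact h)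
  have hE : ¬ Nonempty (vertex (naturalRep G) A ⟶
      vertex (naturalRep G) (A.twist (detRep (naturalRep G)))) := fun h => by
    obtain ⟨φ, hφ⟩ := (Irrep.mult_pos_iff _ _ _).1 ((nonempty_hom_iff _ _ _).1 h)
    exact hφ (intertwiningMap_twist_eq_zero hsmall hSL A φ)
  obtain ⟨Φ, hΦ⟩ := exists_intertwiningMap_tensor_square_ne_zero A
  obtain ⟨C, hAC, hCB⟩ := Irrep.exists_mult_pos (naturalRep G) A _ Φ hΦ
  obtain ⟨e⟩ := (nonempty_hom_iff _ _ _).2 hAC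
  obtain ⟨f⟩ := (nonempty_hom_iff _ _ _).2 hCB
  -- This path has length exactly 2, so the lower bound for all paths also proves it shortest.
  exact ⟨e.toPath.cons f, fun q => two_le_length_of_isEmpty_hom hne hE q, le_rfl⟩
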